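/- Let $p_{[1^33^3]}(n)$ denote the number of partitions of $n$ in which each part that is a multiple of $3$ may appear in any of $6$ colors and each remaining part in any of $3$ colors, with $p_{[1^33^3]}(0)=1$; equivalently, $$\sum_{n=0}^{\infty}p_{[1^33^3]}(n)q^n=\frac{1}{E_1^3E_3^3},\qquad E_m:=\prod_{j\ge 1}(1-q^{mj}).$$ Then for every integer $n\ge 0$, $$p_{[1^33^3]}(5n+3)\equiv 0 \pmod 5.$$ -/

import Mathlib

/-- The number of colors available for the part `m`: a part of size `m` comes in `k` colors if
`r ∤ m`; multiples of `r` come in `k` further colors, so in `2 * k` colors altogether. -/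
def numColors (k r m : ℕ) : ℕ := if r ∣ m then 2 * k else k

/-- A partition of `n` whose parts are colored as described by `numColors k r`: a multiset of
pairs (part, color), in which the parts are positive, the colors of a part `m` are the numbers
`0, …, numColors k r m - 1`, and the parts add up to `n`. -/
@[ext]
structure ColoredPartition (k r n : ℕ) where
  parts : Multiset (ℕ × ℕ)
  parts_pos : ∀ x ∈ parts, 0 < x.1
  color_lt : ∀ x ∈ parts, x.2 < numColors k r x.1
  parts_sum : (parts.map Prod.fst).sum = n

/-- There are finitely many colored partitions of `n`, so that `Nat.card` counts them. -/
instance ColoredPartition.instFinite (k r n : ℕ) : Finite (ColoredPartition k r n) := by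
  have hfin : (Set.Iic (n • (Finset.range (n + 1) ×ˢ Finset.range (2 * k)).val)).Finite :=
    Set.finite_Iic _
  have hmem : ∀ p : ColoredPartition k r n,
      p.parts ∈ Set.Iic (n • (Finset.range (n + 1) ×ˢ Finset.range (2 * k)).val) := by
    intro p
    rw [Set.mem_Iic, Multiset.le_iff_count]
    intro x
    by_cases hx : x ∈ p.parts
    · have hcard : p.parts.card ≤ n := by
        have h := Multiset.card_nsmul_le_sum (s := p.parts.map Prod.fst) (a := 1) (by
          intro y hy
          obtain ⟨z, hz, rfl⟩ := Multiset.mem_map.1 hy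
          exact p.parts_pos z hz)
        rw [p.parts_sum] at h
        simpa using h
      have h1 : x.1 ≤ n := by
        have h := Multiset.single_le_sum (s := p.parts.map Prod.fst) (fun _ _ => Nat.zero_le _)
          x.1 (Multiset.mem_map_of_mem _ hx)
        rwa [p.parts_sum] at h
      have h2 : x.2 < 2 * k := by
        have h := p.color_lt x hx
        unfold numColors at h
        split_ifs at h <;> omega
      have h3 : x ∈ (Finset.range (n + 1) ×ˢ Finset.range (2 * k)).val := by
        rw [Finset.mem_val, Finset.mem_product, Finset.mem_range, Finset.mem_range]
        exact ⟨by omega, h2⟩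
      have h4 := Multiset.one_le_count_iff_mem.2 h3
      have h5 := Multiset.count_le_card x p.parts
      rw [Multiset.count_nsmul]
      nlinarith
    · rw [Multiset.count_eq_zero_of_notMem hx]
      exact Nat.zero_le _
  have : Finite (Set.Iic (n • (Finset.range (n + 1) ×ˢ Finset.range (2 * k)).val)) := hfin
  exact Finite.of_injective
    (fun p => (⟨p.parts, hmem p⟩ :
      Set.Iic (n • (Finset.range (n + 1) ×ˢ Finset.range (2 * k)).val)))
    (fun p q h => ColoredPartition.ext (congrArg Subtype.val h))

/-- The colored partition function `p_{[1^k r^k]}(n)`. -/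
noncomputable def coloredPartitionCount (k r n : ℕ) : ℕ := Nat.card (ColoredPartition k r n)

/-! Modulo 5, `1 / (E₁³ E₃³) = E₁² E₃² / (E₁⁵ E₃⁵)`, and by Frobenius the denominator is a power
series in `q⁵`. Multiplying by a series in `q⁵` does not mix residue classes of exponents, so it
suffices that the coefficients of `E₁² E₃²` at exponents congruent to 3 mod 5 vanish in
characteristic 5 (`coeff_sq_mul_sq_eq_zero`).

This follows from `three_mul_sq_mul_sq_eq`, which writes `3 E₁² E₃²` as a combination of two double
theta series. Their weights and exponents are `6i + 2` with `3i² + 2i + m²`, and `6i - 1` with `3i²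
- i + m² + m`. Completing squares, an exponent congruent to 3 mod 5 gives `u² + 3v² = 0` mod 5, with
`u` proportional to the weight. As `-3` is not a square mod 5, `u = 0` and the term disappears.

To get the representation, Jacobi's series for `E₃³` is multiplied by the pentagonal series for
`E₁`, and the index lattice is rotated by `(a, b) = (i + j, i - j)`, up to a shift
(`three_mul_cube_mul_eq`). This separates the quadratic form in the exponent. A further factor `E₁`
turns the weightless theta factors into `E₃` times theta products twisted by a primitive cube root
of unity (`qPoch_one_mul_theta_four_two`, `qPoch_one_mul_theta_one_five`), and `E₃` cancels. All
theta series come from the Jacobi triple product `hasSum_jacobiTerm`. -/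

open PowerSeries Finset Filter Topology

open scoped PowerSeries.WithPiTopology

/-! ### Infinite q-products as X-adic limits. -/

section QPochhammer

variable {R : Type*} [CommRing R]

/-- The infinite product `∏ (1 - a * Q ^ i)` over `i ≥ 0`, for a power series `Q` without constant
term. -/
noncomputable def qPoch (a Q : R⟦X⟧) : R⟦X⟧ :=
  PowerSeries.mk fun n => coeff n (∏ i ∈ range (n + 1), (1 - a * Q ^ i))

theorem X_pow_dvd_prod_sub_prod {a Q : R⟦X⟧} (hQ : X ∣ Q) {m n : ℕ} (h : m ≤ n) :
    X ^ m ∣ ∏ i ∈ range n, (1 - a * Q ^ i) - ∏ i ∈ range m, (1 - a * Q ^ i) := by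
  induction n, h using Nat.le_induction with
  | base => simp
  | succ n hn ih =>
    have h1 : (X : R⟦X⟧) ^ m ∣ Q ^ n := (pow_dvd_pow X hn).trans (pow_dvd_pow_of_dvd hQ n)
    have h2 := ih.sub (h1.mul_left (a * ∏ i ∈ range n, (1 - a * Q ^ i)))
    rw [prod_range_succ]
    convert h2 using 1
    ring

theorem X_pow_dvd_qPoch_sub_prod {a Q : R⟦X⟧} (hQ : X ∣ Q) (n : ℕ) :
    X ^ n ∣ qPoch a Q - ∏ i ∈ range n, (1 - a * Q ^ i) := by
  rw [X_pow_dvd_iff]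
  intro m hm
  have h := X_pow_dvd_iff.1 (X_pow_dvd_prod_sub_prod (a := a) hQ hm) m (Nat.lt_succ_self m)
  rw [map_sub, sub_eq_zero] at h
  rw [map_sub, qPoch, coeff_mk, h, sub_self]

theorem eq_of_forall_X_pow_dvd_sub {F G : R⟦X⟧} (h : ∀ n : ℕ, X ^ n ∣ F - G) : F = G := by
  ext n
  have := X_pow_dvd_iff.1 (h (n + 1)) n (Nat.lt_succ_self n)
  rwa [map_sub, sub_eq_zero] at this

theorem X_pow_dvd_mul_sub_mul {n : ℕ} {F G F' G' : R⟦X⟧} (h : X ^ n ∣ F - G)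
    (h' : X ^ n ∣ F' - G') : X ^ n ∣ F * F' - G * G' := by
  convert (h.mul_right F').add (h'.mul_left G) using 1
  ring

/-- The factor `k` allows comparison along partial products of length `k * n` only, as needed when
the factors are grouped by residue mod `k`. -/
theorem qPoch_eq_of_forall_dvd {a Q L : R⟦X⟧} (hQ : X ∣ Q) {k : ℕ} (hk : 0 < k)
    (h : ∀ n : ℕ, X ^ n ∣ L - ∏ i ∈ range (k * n), (1 - a * Q ^ i)) : qPoch a Q = L := by
  refine eq_of_forall_X_pow_dvd_sub fun n => ?_
  have h1 := (pow_dvd_pow (X : R⟦X⟧) (Nat.le_mul_of_pos_left n hk)).trans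
    (X_pow_dvd_qPoch_sub_prod (a := a) hQ (k * n))
  convert h1.sub (h n) using 1
  ring

theorem qPoch_dissect_two {a Q : R⟦X⟧} (hQ : X ∣ Q) :
    qPoch a Q = qPoch a (Q ^ 2) * qPoch (a * Q) (Q ^ 2) := by
  have hQ' : X ∣ Q ^ 2 := hQ.trans (dvd_pow_self Q two_ne_zero)
  refine qPoch_eq_of_forall_dvd hQ two_pos fun n => ?_
  convert X_pow_dvd_mul_sub_mul (X_pow_dvd_qPoch_sub_prod (a := a) hQ' n)
    (X_pow_dvd_qPoch_sub_prod (a := a * Q) hQ' n) using 2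
  induction n with
  | zero => simp
  | succ n ih =>
    rw [show 2 * (n + 1) = 2 * n + 1 + 1 by ring, prod_range_succ, prod_range_succ, ih,
      prod_range_succ, prod_range_succ]
    ring

theorem qPoch_dissect_three {a Q : R⟦X⟧} (hQ : X ∣ Q) :
    qPoch a Q = qPoch a (Q ^ 3) * qPoch (a * Q) (Q ^ 3) * qPoch (a * Q ^ 2) (Q ^ 3) := by
  have hQ' : X ∣ Q ^ 3 := hQ.trans (dvd_pow_self Q three_ne_zero)
  refine qPoch_eq_of_forall_dvd hQ three_pos fun n => ?_
  convert X_pow_dvd_mul_sub_mul (X_pow_dvd_mul_sub_mul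
    (X_pow_dvd_qPoch_sub_prod (a := a) hQ' n) (X_pow_dvd_qPoch_sub_prod (a := a * Q) hQ' n))
    (X_pow_dvd_qPoch_sub_prod (a := a * Q ^ 2) hQ' n) using 2
  induction n with
  | zero => simp
  | succ n ih =>
    rw [show 3 * (n + 1) = 3 * n + 1 + 1 + 1 by ring, prod_range_succ, prod_range_succ,
      prod_range_succ, ih, prod_range_succ, prod_range_succ, prod_range_succ]
    ring

theorem qPoch_mul_qPoch_neg {a Q : R⟦X⟧} (hQ : X ∣ Q) :
    qPoch a Q * qPoch (-a) Q = qPoch (a ^ 2) (Q ^ 2) := by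
  symm
  refine qPoch_eq_of_forall_dvd (hQ.trans (dvd_pow_self Q two_ne_zero)) one_pos fun n => ?_
  convert X_pow_dvd_mul_sub_mul (X_pow_dvd_qPoch_sub_prod (a := a) hQ n)
    (X_pow_dvd_qPoch_sub_prod (a := -a) hQ n) using 2
  rw [one_mul, ← prod_mul_distrib]
  refine prod_congr rfl fun i _ => ?_
  ring

theorem qPoch_mul_cube_roots {a Q w : R⟦X⟧} (hQ : X ∣ Q) (hw : 1 + w + w ^ 2 = 0) :
    qPoch a Q * qPoch (w * a) Q * qPoch (w ^ 2 * a) Q = qPoch (a ^ 3) (Q ^ 3) := by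
  symm
  refine qPoch_eq_of_forall_dvd (hQ.trans (dvd_pow_self Q three_ne_zero)) one_pos fun n => ?_
  convert X_pow_dvd_mul_sub_mul (X_pow_dvd_mul_sub_mul (X_pow_dvd_qPoch_sub_prod (a := a) hQ n)
    (X_pow_dvd_qPoch_sub_prod (a := w * a) hQ n))
    (X_pow_dvd_qPoch_sub_prod (a := w ^ 2 * a) hQ n) using 2
  rw [one_mul, ← prod_mul_distrib, ← prod_mul_distrib]
  refine prod_congr rfl fun i _ => ?_
  linear_combination (a * Q ^ i - w * (a * Q ^ i) ^ 2 + (w - 1) * (a * Q ^ i) ^ 3) * hw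

theorem qPoch_pow_char {p : ℕ} [Fact p.Prime] [CharP R p] {a Q : R⟦X⟧} (hQ : X ∣ Q) :
    qPoch a Q ^ p = qPoch (a ^ p) (Q ^ p) := by
  have hp : 0 < p := (Fact.out : p.Prime).pos
  have : CharP R⟦X⟧ p := charP_of_injective_ringHom (f := (C : R →+* R⟦X⟧)) C_injective p
  symm
  refine qPoch_eq_of_forall_dvd (hQ.trans (dvd_pow_self Q hp.ne')) one_pos fun n => ?_
  have h : ∏ i ∈ range (1 * n), (1 - a ^ p * (Q ^ p) ^ i)
      = (∏ i ∈ range n, (1 - a * Q ^ i)) ^ p := by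
    rw [one_mul, ← prod_pow]
    refine prod_congr rfl fun i _ => ?_
    rw [sub_pow_char, one_pow, mul_pow]
    ring
  rw [h]
  exact (X_pow_dvd_qPoch_sub_prod hQ n).trans (sub_dvd_pow_sub_pow _ _ p)

/-- Needed mostly for constant `a`, where the peeled factor `1 - a` can be zero, nilpotent or a
constant unit. -/
theorem qPoch_eq_one_sub_mul {a Q : R⟦X⟧} (hQ : X ∣ Q) :
    qPoch a Q = (1 - a) * qPoch (a * Q) Q := by
  refine eq_of_forall_X_pow_dvd_sub fun n => ?_
  have h1 := (pow_dvd_pow (X : R⟦X⟧) n.le_succ).trans (X_pow_dvd_qPoch_sub_prod (a := a) hQ (n + 1))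
  have h2 := (X_pow_dvd_qPoch_sub_prod (a := a * Q) hQ n).mul_left (1 - a)
  have h3 : ∏ i ∈ range (n + 1), (1 - a * Q ^ i)
      = (1 - a) * ∏ i ∈ range n, (1 - a * Q * Q ^ i) := by
    rw [prod_range_succ', mul_comm]
    simp [pow_succ', mul_assoc]
  rw [h3] at h1
  convert h1.sub h2 using 1
  ring

theorem map_qPoch {S : Type*} [CommRing S] (f : R →+* S) (a Q : R⟦X⟧) :
    (qPoch a Q).map f = qPoch (a.map f) (Q.map f) := by
  ext n
  rw [coeff_map, qPoch, qPoch, coeff_mk, coeff_mk, ← coeff_map, map_prod]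
  simp

theorem isUnit_qPoch {a Q : R⟦X⟧} (ha : X ∣ a) : IsUnit (qPoch a Q) := by
  have ha0 : constantCoeff a = 0 := X_dvd_iff.1 ha
  rw [isUnit_iff_constantCoeff, ← coeff_zero_eq_constantCoeff_apply, qPoch, coeff_mk]
  simp [ha0]

theorem isUnit_prod_one_sub {a Q : R⟦X⟧} (ha : X ∣ a) (n : ℕ) :
    IsUnit (∏ i ∈ range n, (1 - a * Q ^ i)) := by
  have ha0 : constantCoeff a = 0 := X_dvd_iff.1 ha
  rw [isUnit_iff_constantCoeff]
  simp [map_prod, ha0]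

end QPochhammer

/-! ### The Jacobi triple product. -/

section TripleProduct

/-- The triangular number `m (m + 1) / 2` of an integer. -/
def tri (m : ℤ) : ℕ := (m * (m + 1) / 2).toNat

theorem two_mul_tri (m : ℤ) : 2 * (tri m : ℤ) = m * (m + 1) := by
  have h0 : 0 ≤ m * (m + 1) := by
    rcases le_or_gt 0 m with h | h
    · positivity
    · nlinarith
  have h1 : 2 ∣ m * (m + 1) := (Int.even_mul_succ_self m).two_dvd
  unfold tri
  omega

theorem tri_sub_one (m : ℤ) : (tri (m - 1) : ℤ) = tri m - m := by
  have h1 := two_mul_tri m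
  have h2 := two_mul_tri (m - 1)
  linarith

theorem abs_le_tri_add_one (m : ℤ) : |m| ≤ tri m + 1 := by
  have h1 := two_mul_tri m
  rw [abs_le]
  constructor <;> nlinarith

variable {R : Type*} [CommRing R]

/-- The summands of the Jacobi triple product identity. -/
def jacobiTerm {A : Type*} [CommRing A] (y w : A) (m : ℤ) : A := y ^ tri m * w ^ tri (m - 1)

theorem jacobiTerm_zero {A : Type*} [CommRing A] (y w : A) : jacobiTerm y w 0 = 1 := by
  simp [jacobiTerm, tri]

theorem mul_pow_mul_jacobiTerm {A : Type*} [CommRing A] (y w : A) (M k : ℕ) (m : ℤ)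
    (h : (k : ℤ) = M - m) :
    y * (y * w) ^ M * jacobiTerm y w m = (y * w) ^ k * jacobiTerm y w (m + 1) := by
  have h1 := tri_sub_one m
  have h2 := tri_sub_one (m + 1)
  rw [add_sub_cancel_right] at h2
  have e1 : 1 + M + tri m = k + tri (m + 1) := by omega
  have e2 : M + tri (m - 1) = k + tri m := by omega
  calc y * (y * w) ^ M * jacobiTerm y w m = y ^ (1 + M + tri m) * w ^ (M + tri (m - 1)) := by
        unfold jacobiTerm; ring
    _ = y ^ (k + tri (m + 1)) * w ^ (k + tri m) := by rw [e1, e2]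
    _ = _ := by unfold jacobiTerm; rw [add_sub_cancel_right]; ring

theorem mul_pow_mul_jacobiTerm' {A : Type*} [CommRing A] (y w : A) (N k : ℕ) (m : ℤ)
    (h : (k : ℤ) = N + m) :
    w * (y * w) ^ N * jacobiTerm y w m = (y * w) ^ k * jacobiTerm y w (m - 1) := by
  have h1 := tri_sub_one m
  have h2 := tri_sub_one (m - 1)
  have e1 : N + tri m = k + tri (m - 1) := by omega
  have e2 : 1 + N + tri (m - 1) = k + tri (m - 1 - 1) := by omega
  calc w * (y * w) ^ N * jacobiTerm y w m = y ^ (N + tri m) * w ^ (1 + N + tri (m - 1)) := by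
        unfold jacobiTerm; ring
    _ = y ^ (k + tri (m - 1)) * w ^ (k + tri (m - 1 - 1)) := by rw [e1, e2]
    _ = _ := by unfold jacobiTerm; ring

/-- A finite form of the Jacobi triple product identity; `e k` is the inverse of `(Q; Q)_k`. -/
theorem finite_triple_product {A : Type*} [CommRing A] (y w : A) (e : ℕ → A)
    (h0 : e 0 = 1) (he : ∀ k, e (k + 1) * (1 - (y * w) ^ (k + 1)) = e k) (M N : ℕ) :
    (∏ i ∈ range M, (1 + y * (y * w) ^ i)) * ∏ i ∈ range N, (1 + w * (y * w) ^ i) =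
      (∏ i ∈ range (M + N), (1 - (y * w) * (y * w) ^ i)) *
        ∑ k ∈ range (M + N + 1), e k * e (M + N - k) * jacobiTerm y w (k - N) := by
  induction M with
  | zero =>
    induction N with
    | zero => simp [h0, jacobiTerm_zero]
    | succ N ih =>
      rw [zero_add] at ih ⊢
      rw [prod_range_succ, ← mul_assoc, ih, prod_range_succ, mul_assoc, mul_assoc]
      congr 1
      -- The q-Pascal rule, with `Q = y * w`: `1 - Q ^ (N + 1) = (1 - Q ^ k) + Q ^ k * (1 - Q ^ (N +
      -- 1 - k))`.
      have hr : (1 - y * w * (y * w) ^ N) * ∑ k ∈ range (N + 1 + 1),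
            e k * e (N + 1 - k) * jacobiTerm y w (k - (N + 1 : ℕ)) =
          ∑ k ∈ range (N + 1 + 1), (e k * (1 - (y * w) ^ k)) * e (N + 1 - k) *
            jacobiTerm y w (k - (N + 1 : ℕ)) +
          ∑ k ∈ range (N + 1 + 1), (y * w) ^ k * e k *
            (e (N + 1 - k) * (1 - (y * w) ^ (N + 1 - k))) * jacobiTerm y w (k - (N + 1 : ℕ)) := by
        rw [mul_sum, ← sum_add_distrib]
        refine sum_congr rfl fun k hk => ?_
        have hk' : k + (N + 1 - k) = N + 1 := by have := mem_range.1 hk; omega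
        have : y * w * (y * w) ^ N = (y * w) ^ k * (y * w) ^ (N + 1 - k) := by
          rw [← pow_add, hk', pow_succ']
        rw [this]; ring
      rw [hr, sum_range_succ' _ (N + 1), sum_range_succ (fun k => (y * w) ^ k * e k *
            (e (N + 1 - k) * (1 - (y * w) ^ (N + 1 - k))) * jacobiTerm y w (k - (N + 1 : ℕ))),
        sum_mul]
      simp only [pow_zero, sub_self, mul_zero, zero_mul, add_zero, Nat.sub_self]
      rw [← sum_add_distrib]
      refine sum_congr rfl fun k hk => ?_
      have hk' : k ≤ N := by have := mem_range.1 hk; omega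
      rw [he, show N + 1 - (k + 1) = N - k by omega, show N + 1 - k = N - k + 1 by omega, he]
      have h1 := mul_pow_mul_jacobiTerm' y w N k (k - N) (by ring)
      have e1 : ((k + 1 : ℕ) : ℤ) - (N + 1 : ℕ) = k - N := by push_cast; ring
      have e2 : (k : ℤ) - (N + 1 : ℕ) = k - N - 1 := by push_cast; ring
      rw [e1, e2]
      linear_combination e k * e (N - k) * h1
  | succ M ih =>
    obtain ⟨n, hn⟩ : ∃ n, M + N = n := ⟨_, rfl⟩
    rw [show M + 1 + N = n + 1 by omega]
    rw [hn] at ih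
    rw [prod_range_succ, mul_right_comm, ih, prod_range_succ, mul_assoc, mul_assoc]
    congr 1
    -- The mirror q-Pascal rule, with the roles of `k` and `n + 1 - k` exchanged.
    have hr : (1 - y * w * (y * w) ^ n) * ∑ k ∈ range (n + 1 + 1),
          e k * e (n + 1 - k) * jacobiTerm y w (k - N) =
        ∑ k ∈ range (n + 1 + 1), e k * (e (n + 1 - k) * (1 - (y * w) ^ (n + 1 - k))) *
          jacobiTerm y w (k - N) +
        ∑ k ∈ range (n + 1 + 1), (y * w) ^ (n + 1 - k) * (e k * (1 - (y * w) ^ k)) *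
          e (n + 1 - k) * jacobiTerm y w (k - N) := by
      rw [mul_sum, ← sum_add_distrib]
      refine sum_congr rfl fun k hk => ?_
      have hk' : k + (n + 1 - k) = n + 1 := by have := mem_range.1 hk; omega
      have : y * w * (y * w) ^ n = (y * w) ^ k * (y * w) ^ (n + 1 - k) := by
        rw [← pow_add, hk', pow_succ']
      rw [this]; ring
    rw [hr, sum_range_succ' (fun k => (y * w) ^ (n + 1 - k) * (e k * (1 - (y * w) ^ k)) *
          e (n + 1 - k) * jacobiTerm y w (k - N)), sum_range_succ _ (n + 1), sum_mul]
    simp only [pow_zero, sub_self, mul_zero, zero_mul, add_zero, Nat.sub_self]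
    rw [← sum_add_distrib]
    refine sum_congr rfl fun k hk => ?_
    have hk' : k ≤ n := by have := mem_range.1 hk; omega
    rw [he, show n + 1 - (k + 1) = n - k by omega, show n + 1 - k = n - k + 1 by omega, he]
    have h1 := mul_pow_mul_jacobiTerm y w M (n - k) (k - N) (by omega)
    have e1 : ((k + 1 : ℕ) : ℤ) - N = k - N + 1 := by push_cast; ring
    rw [e1]
    linear_combination e k * e (n - k) * h1

/-- Only `y * w` need be divisible by `X`, so the common power `(y * w) ^ min` is what supplies the
divisibility; either factor alone may be a constant. -/
theorem X_pow_dvd_jacobiTerm {y w : R⟦X⟧} (h : X ∣ y * w) {d : ℕ} {m : ℤ} (hm : (d : ℤ) < |m|) :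
    X ^ d ∣ jacobiTerm y w m := by
  have h1 := tri_sub_one m
  have h2 := abs_le_tri_add_one m
  have h3 := abs_le_tri_add_one (m - 1)
  have hd : d ≤ min (tri m) (tri (m - 1)) := by
    rw [le_min_iff]
    have := two_mul_tri m
    have := two_mul_tri (m - 1)
    rcases le_or_gt 0 m with hp | hp
    · rw [abs_of_nonneg hp] at *
      constructor
      · omega
      · have : (d : ℤ) ≤ tri (m - 1) := by nlinarith
        omega
    · rw [abs_of_neg hp] at *
      constructor
      · omega
      · omega
  have h4 : (y * w) ^ min (tri m) (tri (m - 1)) ∣ jacobiTerm y w m := by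
    rw [mul_pow]
    exact mul_dvd_mul (pow_dvd_pow _ (min_le_left _ _)) (pow_dvd_pow _ (min_le_right _ _))
  exact ((pow_dvd_pow X hd).trans (pow_dvd_pow_of_dvd h _)).trans h4

theorem tendsto_of_eventually_X_pow_dvd [TopologicalSpace R] {ι : Type*} {l : Filter ι}
    {f : ι → R⟦X⟧} {L : R⟦X⟧}
    (h : ∀ d : ℕ, ∀ᶠ i in l, X ^ d ∣ f i - L) : Tendsto f l (𝓝 L) := by
  rw [WithPiTopology.tendsto_iff_coeff_tendsto]
  intro d
  refine tendsto_const_nhds.congr' ?_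
  filter_upwards [h (d + 1)] with i hi
  have := X_pow_dvd_iff.1 hi d (Nat.lt_succ_self d)
  rwa [map_sub, sub_eq_zero, eq_comm] at this

theorem X_pow_dvd_triple_product_sub_sum {y w : R⟦X⟧} (h : X ∣ y * w) {d : ℕ} {s : Finset ℤ}
    (hs : Icc (-(d : ℤ)) d ⊆ s) :
    X ^ d ∣ qPoch (-y) (y * w) * qPoch (-w) (y * w) * qPoch (y * w) (y * w)
      - ∑ m ∈ s, jacobiTerm y w m := by
  set Q := y * w with hQ
  have hu : ∀ n, IsUnit (∏ i ∈ range n, (1 - Q * Q ^ i)) := isUnit_prod_one_sub h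
  choose u hu using hu
  set e : ℕ → R⟦X⟧ := fun n => ((u n)⁻¹ : R⟦X⟧ˣ) with he
  have hue : ∀ n, (∏ i ∈ range n, (1 - Q * Q ^ i)) * e n = 1 := fun n => by
    rw [← hu]; exact (u n).mul_inv
  have e0 : e 0 = 1 := by simpa using hue 0
  have e1 : ∀ k, e (k + 1) * (1 - Q ^ (k + 1)) = e k := fun k => by
    have h1 := hue k
    have h2 := hue (k + 1)
    rw [prod_range_succ] at h2
    linear_combination e k * h2 - (1 - Q ^ (k + 1)) * e (k + 1) * h1
  set E := qPoch Q Q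
  have hE : ∀ n, d ≤ n → X ^ d ∣ E * e n - 1 := fun n hn => by
    have := ((pow_dvd_pow X hn).trans (X_pow_dvd_qPoch_sub_prod (a := Q) h n)).mul_right (e n)
    rwa [sub_mul, hue] at this
  -- With `N = 2 * d`, every `k ≤ 2 * N` either has both `k` and `2 * N - k` at least `d`, or
  -- satisfies `|k - N| > d`.
  obtain ⟨N, hN⟩ : ∃ N, N = 2 * d := ⟨_, rfl⟩
  have hfin := finite_triple_product y w e e0 e1 N N
  rw [← hQ] at hfin
  have hlim : X ^ d ∣ qPoch (-y) Q * qPoch (-w) Q * E -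
      (∏ i ∈ range N, (1 - (-y) * Q ^ i)) * (∏ i ∈ range N, (1 - (-w) * Q ^ i)) * E := by
    have hd : (X : R⟦X⟧) ^ d ∣ X ^ N := pow_dvd_pow X (by omega)
    refine X_pow_dvd_mul_sub_mul (X_pow_dvd_mul_sub_mul ?_ ?_) (by simp)
    · exact hd.trans (X_pow_dvd_qPoch_sub_prod h N)
    · exact hd.trans (X_pow_dvd_qPoch_sub_prod h N)
  simp only [neg_mul, sub_neg_eq_add] at hlim
  rw [hfin] at hlim
  have hsum : X ^ d ∣ ∑ k ∈ range (N + N + 1), (∏ i ∈ range (N + N), (1 - Q * Q ^ i)) * E *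
      (e k * e (N + N - k) * jacobiTerm y w (k - N)) - ∑ m ∈ s, jacobiTerm y w m := by
    have hA : ∑ k ∈ range (N + N + 1), jacobiTerm y w (k - N) =
        ∑ m ∈ Icc (-(N : ℤ)) N, jacobiTerm y w m := by
      refine sum_bij (fun k _ => (k : ℤ) - N) ?_ ?_ ?_ ?_
      · intro k hk
        rw [mem_range] at hk
        rw [Finset.mem_Icc]; omega
      · intro a _ b _ hab
        omega
      · intro m hm
        rw [Finset.mem_Icc] at hm
        exact ⟨(m + N).toNat, by rw [mem_range]; omega, by omega⟩
      · intros; rfl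
    have hB : ∀ t : Finset ℤ, Icc (-(d : ℤ)) d ⊆ t →
        X ^ d ∣ ∑ m ∈ t, jacobiTerm y w m - ∑ m ∈ Icc (-(d : ℤ)) d, jacobiTerm y w m := by
      intro t ht
      rw [← sum_sdiff ht, add_sub_cancel_right]
      refine dvd_sum fun m hm => X_pow_dvd_jacobiTerm h ?_
      rw [Finset.mem_sdiff, Finset.mem_Icc, ← abs_le] at hm
      exact not_le.1 hm.2
    have hC := dvd_sub (hB (Icc (-(N : ℤ)) N) (Finset.Icc_subset_Icc (by omega) (by omega)))
      (hB s hs)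
    rw [sub_sub_sub_cancel_right, ← hA] at hC
    convert dvd_add hC (?_ : X ^ d ∣ ∑ k ∈ range (N + N + 1),
      ((∏ i ∈ range (N + N), (1 - Q * Q ^ i)) * E * (e k * e (N + N - k)) - 1) *
        jacobiTerm y w (k - N)) using 1
    · simp only [sub_mul, sum_sub_distrib, one_mul, mul_assoc]
      ring
    · refine dvd_sum fun k hk => ?_
      rw [mem_range] at hk
      -- Central terms have coefficient 1 mod `X ^ d`, since `e k` approximates `1 / E`; for the
      -- outer terms the theta summand itself vanishes mod `X ^ d`.
      by_cases hk' : d ≤ k ∧ d ≤ N + N - k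
      · refine Dvd.dvd.mul_right ?_ _
        have h1 := hE k hk'.1
        have h2 := hE (N + N - k) hk'.2
        have h3 : X ^ d ∣ E - ∏ i ∈ range (N + N), (1 - Q * Q ^ i) :=
          (pow_dvd_pow X (by omega)).trans (X_pow_dvd_qPoch_sub_prod (a := Q) h (N + N))
        convert ((X_pow_dvd_mul_sub_mul h1 h2).sub ((h3.mul_left (E * e k * e (N + N - k))))) using 1
        ring
      · refine Dvd.dvd.mul_left (X_pow_dvd_jacobiTerm h ?_) _
        rw [lt_abs]
        omega
  rw [← mul_sum] at hsum
  convert dvd_add hlim hsum using 1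
  ring

/-- The Jacobi triple product identity for power series. -/
theorem hasSum_jacobiTerm [TopologicalSpace R] {y w : R⟦X⟧} (h : X ∣ y * w) :
    HasSum (jacobiTerm y w)
      (qPoch (-y) (y * w) * qPoch (-w) (y * w) * qPoch (y * w) (y * w)) := by
  refine tendsto_of_eventually_X_pow_dvd fun d => ?_
  filter_upwards [eventually_ge_atTop (Icc (-(d : ℤ)) d)] with s hs
  rw [dvd_sub_comm]
  exact X_pow_dvd_triple_product_sub_sum h hs

end TripleProduct

/-! ### Product identities with a cube root of unity. -/

section ProductIdentities

/-- Euler's identity between partitions into odd parts and partitions into distinct parts, in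
product form. -/
theorem qPoch_self_sq_mul_qPoch_neg {R : Type*} [CommRing R] {Q : R⟦X⟧} (hQ : X ∣ Q) :
    qPoch Q (Q ^ 2) * qPoch (-Q) Q = 1 := by
  have hQ' : X ∣ Q ^ 2 := hQ.trans (dvd_pow_self Q two_ne_zero)
  refine (isUnit_qPoch (Q := Q ^ 2) hQ').mul_left_cancel ?_
  have h1 := qPoch_dissect_two (a := Q) hQ
  have h2 := qPoch_mul_qPoch_neg (a := Q) hQ
  rw [← pow_two] at h1
  rw [h1] at h2
  linear_combination h2

variable {R : Type*} [CommRing R] {w : R⟦X⟧}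

theorem X_dvd_X_pow {n : ℕ} (hn : n ≠ 0) : (X : R⟦X⟧) ∣ X ^ n := dvd_pow_self X hn

/-- After multiplication by the units `(-X; X²)` and `(-X⁶; X⁶)`, both sides collapse to `(X²; X²)
(X⁶; X⁶)`: the left by 3-dissection of `(-X²; X²)`, the right by the product over cube roots of
unity, each finished with Euler's identity. -/
theorem qPoch_one_mul_theta_four_two (hw : 1 + w + w ^ 2 = 0) :
    qPoch X X * (qPoch (-X ^ 4) (X ^ 6) * qPoch (-X ^ 2) (X ^ 6) * qPoch (X ^ 6) (X ^ 6)) =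
      qPoch (X ^ 3) (X ^ 3) *
        (qPoch (-(w * X)) (X ^ 2) * qPoch (-(w ^ 2 * X)) (X ^ 2) *
          qPoch (X ^ 2 : R⟦X⟧) (X ^ 2)) := by
  have h2 : (X : R⟦X⟧) ∣ X ^ 2 := X_dvd_X_pow two_ne_zero
  have h3 : (X : R⟦X⟧) ∣ X ^ 3 := X_dvd_X_pow three_ne_zero
  have h6 : (X : R⟦X⟧) ∣ X ^ 6 := X_dvd_X_pow (by norm_num)
  have a := qPoch_dissect_two (a := (X : R⟦X⟧)) dvd_rfl
  have b := qPoch_dissect_two (a := (X ^ 3 : R⟦X⟧)) h3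
  have c := qPoch_mul_cube_roots (a := -X) h2 hw
  have d := qPoch_mul_qPoch_neg (a := (X : R⟦X⟧)) h2
  have e := qPoch_mul_qPoch_neg (a := (X ^ 3 : R⟦X⟧)) h6
  have f := qPoch_dissect_three (a := -(X ^ 2 : R⟦X⟧)) h2
  have g := qPoch_self_sq_mul_qPoch_neg (Q := (X ^ 2 : R⟦X⟧)) h2
  have g' := qPoch_self_sq_mul_qPoch_neg (Q := (X ^ 6 : R⟦X⟧)) h6
  simp only [← pow_mul, neg_mul, ← pow_add, ← pow_two (X : R⟦X⟧), mul_neg,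
    Odd.neg_pow (⟨1, rfl⟩ : Odd 3), Nat.reduceMul, Nat.reduceAdd] at *
  refine ((isUnit_qPoch (Q := X ^ 2) (dvd_neg.2 (dvd_refl (X : R⟦X⟧)))).mul
    (isUnit_qPoch (Q := X ^ 6) (dvd_neg.2 h6))).mul_left_cancel ?_
  set qX := qPoch (X : R⟦X⟧) (X ^ 2)
  set q22 := qPoch (X ^ 2 : R⟦X⟧) (X ^ 2)
  set q66 := qPoch (X ^ 6 : R⟦X⟧) (X ^ 6)
  set q36 := qPoch (X ^ 3 : R⟦X⟧) (X ^ 6)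
  set m1 := qPoch (-X : R⟦X⟧) (X ^ 2)
  set m66 := qPoch (-X ^ 6 : R⟦X⟧) (X ^ 6)
  rw [a, b]
  calc _ = (qX * m1) * q22 * q66 *
        (qPoch (-X ^ 2) (X ^ 6) * qPoch (-X ^ 4) (X ^ 6) * m66) := by ring
    _ = q22 * q66 := by rw [← f, d]; linear_combination q22 * q66 * g
    _ = q22 * q66 * (q36 * (m1 * qPoch (-(w * X)) (X ^ 2) * qPoch (-(w ^ 2 * X)) (X ^ 2)) * m66) := by
      rw [c, e, g', mul_one]
    _ = _ := by ring

/-- The same argument with the units `(-X²; X²)` and `(-X³; X⁶)`, now dissecting `(-X; X²)`. -/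
theorem qPoch_one_mul_theta_one_five (hw : 1 + w + w ^ 2 = 0) :
    qPoch X X * (qPoch (-X) (X ^ 6) * qPoch (-X ^ 5) (X ^ 6) * qPoch (X ^ 6) (X ^ 6)) =
      qPoch (X ^ 3) (X ^ 3) *
        (qPoch (-(w * X ^ 2)) (X ^ 2) * qPoch (-(w ^ 2 * X ^ 2)) (X ^ 2) *
          qPoch (X ^ 2 : R⟦X⟧) (X ^ 2)) := by
  have h2 : (X : R⟦X⟧) ∣ X ^ 2 := X_dvd_X_pow two_ne_zero
  have h3 : (X : R⟦X⟧) ∣ X ^ 3 := X_dvd_X_pow three_ne_zero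
  have h6 : (X : R⟦X⟧) ∣ X ^ 6 := X_dvd_X_pow (by norm_num)
  have a := qPoch_dissect_two (a := (X : R⟦X⟧)) dvd_rfl
  have b := qPoch_dissect_two (a := (X ^ 3 : R⟦X⟧)) h3
  have c := qPoch_mul_cube_roots (a := -X ^ 2) h2 hw
  have d := qPoch_mul_qPoch_neg (a := (X : R⟦X⟧)) h2
  have e := qPoch_mul_qPoch_neg (a := (X ^ 3 : R⟦X⟧)) h6
  have f := qPoch_dissect_three (a := -(X : R⟦X⟧)) h2
  have g := qPoch_self_sq_mul_qPoch_neg (Q := (X ^ 2 : R⟦X⟧)) h2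
  have g' := qPoch_self_sq_mul_qPoch_neg (Q := (X ^ 6 : R⟦X⟧)) h6
  simp only [← pow_mul, neg_mul, ← pow_add, ← pow_succ' (X : R⟦X⟧), ← pow_two (X : R⟦X⟧), mul_neg,
    Odd.neg_pow (⟨1, rfl⟩ : Odd 3), Nat.reduceMul, Nat.reduceAdd] at *
  refine ((isUnit_qPoch (Q := X ^ 2) (dvd_neg.2 h2)).mul
    (isUnit_qPoch (Q := X ^ 6) (dvd_neg.2 h3))).mul_left_cancel ?_
  set qX := qPoch (X : R⟦X⟧) (X ^ 2)
  set q22 := qPoch (X ^ 2 : R⟦X⟧) (X ^ 2)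
  set q66 := qPoch (X ^ 6 : R⟦X⟧) (X ^ 6)
  set q36 := qPoch (X ^ 3 : R⟦X⟧) (X ^ 6)
  set m22 := qPoch (-X ^ 2 : R⟦X⟧) (X ^ 2)
  set m36 := qPoch (-X ^ 3 : R⟦X⟧) (X ^ 6)
  rw [a, b]
  calc _ = (qX * (qPoch (-X) (X ^ 6) * m36 * qPoch (-X ^ 5) (X ^ 6))) * q22 * q66 * m22 := by ring
    _ = q22 * q66 := by rw [← f, d]; linear_combination q22 * q66 * g
    _ = q22 * q66 * ((q36 * m36) *
        (m22 * qPoch (-(w * X ^ 2)) (X ^ 2) * qPoch (-(w ^ 2 * X ^ 2)) (X ^ 2))) := by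
      rw [c, e, g', mul_one]
    _ = _ := by ring

end ProductIdentities

/-! ### Theta series as sums of monomials. -/

section Theta

variable {R : Type*} [CommRing R]

/-- The exponent `α m (m + 1) / 2 + β m (m - 1) / 2`. -/
def thetaExp (α β : ℕ) (m : ℤ) : ℕ := α * tri m + β * tri (m - 1)

theorem two_mul_thetaExp (α β : ℕ) (m : ℤ) :
    2 * (thetaExp α β m : ℤ) = α * (m * (m + 1)) + β * (m * (m - 1)) := by
  have h1 := two_mul_tri m
  have h2 := two_mul_tri (m - 1)
  rw [thetaExp]
  push_cast
  linear_combination α * h1 + β * h2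

theorem finite_thetaExp_le {α β : ℕ} (hα : α ≠ 0) (n : ℕ) : {m | thetaExp α β m ≤ n}.Finite := by
  refine (Set.finite_Icc (-(n + 1 : ℤ)) (n + 1)).subset fun m hm => ?_
  have h1 : tri m ≤ n := ((Nat.le_mul_of_pos_left _ (Nat.pos_of_ne_zero hα)).trans
    (Nat.le_add_right _ _)).trans hm
  have h2 := abs_le_tri_add_one m
  rw [Set.mem_Icc, ← abs_le]
  omega

theorem jacobiTerm_monomial (α β : ℕ) (c d : R) (m : ℤ) :
    jacobiTerm (monomial α c) (monomial β d) m = monomial (thetaExp α β m) (jacobiTerm c d m) := by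
  simp only [jacobiTerm, thetaExp, monomial_pow, monomial_mul_monomial]
  congr 2
  ring

variable [TopologicalSpace R]

/-- Each coefficient receives only finitely many terms, so the topology on `R` plays no role. -/
theorem summable_monomial {ι : Type*} {e : ι → ℕ} (he : ∀ n, {i | e i ≤ n}.Finite) (c : ι → R) :
    Summable fun i => monomial (e i) (c i) := by
  rw [WithPiTopology.summable_iff_summable_coeff]
  intro n
  refine summable_of_hasFiniteSupport ((he n).subset fun i hi => ?_)
  rw [Function.mem_support, coeff_monomial] at hi
  exact (of_not_not fun h => hi (if_neg h) : n = e i).ge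

theorem finite_add_le {ι κ : Type*} {e : ι → ℕ} {e' : κ → ℕ} (he : ∀ n, {i | e i ≤ n}.Finite)
    (he' : ∀ n, {i | e' i ≤ n}.Finite) (n : ℕ) : {p : ι × κ | e p.1 + e' p.2 ≤ n}.Finite :=
  ((he n).prod (he' n)).subset fun _ hp =>
    ⟨(Nat.le_add_right _ _).trans hp, (Nat.le_add_left _ _).trans hp⟩

theorem hasSum_monomial_mul [IsTopologicalRing R] [T2Space R] {ι κ : Type*} {e : ι → ℕ}
    {e' : κ → ℕ} (he : ∀ n, {i | e i ≤ n}.Finite) (he' : ∀ n, {i | e' i ≤ n}.Finite) {c : ι → R}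
    {c' : κ → R} {F G : R⟦X⟧} (hF : HasSum (fun i => monomial (e i) (c i)) F)
    (hG : HasSum (fun i => monomial (e' i) (c' i)) G) :
    HasSum (fun p : ι × κ => monomial (e p.1 + e' p.2) (c p.1 * c' p.2)) (F * G) := by
  have h : ∀ p : ι × κ, (monomial (e p.1 + e' p.2) (c p.1 * c' p.2) : R⟦X⟧) =
      monomial (e p.1) (c p.1) * monomial (e' p.2) (c' p.2) := fun p =>
    (monomial_mul_monomial _ _ _ _).symm
  have hs : Summable fun p : ι × κ => (monomial (e p.1 + e' p.2) (c p.1 * c' p.2) : R⟦X⟧) :=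
    summable_monomial (finite_add_le he he') _
  exact (HasSum.mul hF hG (hs.congr h)).congr_fun h

theorem coeff_eq_zero_of_hasSum_monomial [T2Space R] {ι : Type*} {e : ι → ℕ} {c : ι → R} {F : R⟦X⟧}
    (hF : HasSum (fun i => monomial (e i) (c i)) F) {n : ℕ} (h : ∀ i, e i = n → c i = 0) :
    coeff n F = 0 := by
  have h1 := ((WithPiTopology.hasSum_iff_hasSum_coeff R).1 hF) n
  have h2 : (fun i => coeff n (monomial (e i) (c i))) = fun _ => (0 : R) := by
    funext i
    rw [coeff_monomial]
    split_ifs with hi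
    · exact h i hi.symm
    · rfl
  rw [h2] at h1
  exact h1.unique hasSum_zero

/-- The Jacobi triple product identity for the theta series `∑ c X ^ (α tri m + β tri (m - 1))`. -/
theorem hasSum_theta {α β : ℕ} (h : α + β ≠ 0) {c d : R} (hcd : c * d = 1) :
    HasSum (fun m => monomial (thetaExp α β m) (jacobiTerm c d m))
      (qPoch (-(C c * X ^ α)) (X ^ (α + β)) * qPoch (-(C d * X ^ β)) (X ^ (α + β)) *
        qPoch (X ^ (α + β)) (X ^ (α + β))) := by
  have hm : (monomial α c : R⟦X⟧) * monomial β d = X ^ (α + β) := by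
    rw [monomial_mul_monomial, hcd, X_pow_eq]
  have := hasSum_jacobiTerm (y := (monomial α c : R⟦X⟧)) (w := monomial β d)
    (by rw [hm]; exact X_dvd_X_pow h)
  rw [hm, funext (jacobiTerm_monomial α β c d)] at this
  simpa only [← monomial_eq_C_mul_X_pow] using this

end Theta

/-! ### Jacobi's cube identity via dual numbers. -/

section Cube

variable {R : Type*} [CommRing R]

theorem jacobiTerm_neg_one (m : ℤ) : jacobiTerm (-1 : R) (-1) m = ((m.negOnePow : ℤ) : R) := by
  have h1 := two_mul_tri m
  have h2 := tri_sub_one m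
  have h3 : ((tri m + tri (m - 1) : ℕ) : ℤ) = m * m := by push_cast; linarith
  rw [jacobiTerm, ← pow_add]
  rcases Int.even_or_odd m with h | h
  · have h4 : Even (tri m + tri (m - 1)) := by
      rw [← Int.even_coe_nat, h3]
      exact h.mul_left m
    rw [h4.neg_one_pow, Int.negOnePow_even m h]
    simp
  · have h4 : Odd (tri m + tri (m - 1)) := by
      rw [← Int.odd_coe_nat, h3]
      exact h.mul h
    rw [h4.neg_one_pow, Int.negOnePow_odd m h]
    simp

open DualNumber in
theorem snd_jacobiTerm_one_add_eps (m : ℤ) :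
    (jacobiTerm (-(1 + ε) : R[ε]) (-(1 - ε)) m).snd = ((m.negOnePow : ℤ) : R) * m := by
  have hpos : ∀ k : ℕ, (1 + ε : R[ε]) ^ k = 1 + (k : R[ε]) * ε := fun k => by
    induction k with
    | zero => simp
    | succ k ih =>
      rw [pow_succ, ih]
      push_cast
      linear_combination (k : R[ε]) * (eps_mul_eps (R := R))
  have hneg : ∀ k : ℕ, (1 - ε : R[ε]) ^ k = 1 - (k : R[ε]) * ε := fun k => by
    induction k with
    | zero => simp
    | succ k ih =>
      rw [pow_succ, ih]
      push_cast
      linear_combination (k : R[ε]) * (eps_mul_eps (R := R))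
  have h2 := tri_sub_one m
  have h3 : ((tri (m - 1) : ℤ) : R[ε]) = ((tri m - m : ℤ) : R[ε]) := by rw [h2]
  push_cast at h3
  have h1 : jacobiTerm (-(1 + ε) : R[ε]) (-(1 - ε)) m =
      ((m.negOnePow : ℤ) : R[ε]) * (1 + (m : R[ε]) * ε) := by
    rw [← jacobiTerm_neg_one, jacobiTerm, jacobiTerm, neg_pow, neg_pow (1 - ε : R[ε]), hpos, hneg,
      h3]
    linear_combination (-(-1 : R[ε]) ^ tri m * (-1) ^ tri (m - 1) * tri m * (tri m - m)) *
      (eps_mul_eps (R := R))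
  rw [h1]
  simp

variable [TopologicalSpace R]

open DualNumber in
/-- Jacobi's identity for the cube of the Euler product. -/
theorem hasSum_qPoch_cube {r : ℕ} (hr : r ≠ 0) :
    HasSum (fun m : ℤ => (monomial (thetaExp r 0 m) (((m.negOnePow : ℤ) : R) * m) : R⟦X⟧))
      (qPoch (X ^ r) (X ^ r) ^ 3) := by
  have hX : (X : R[ε]⟦X⟧) ∣ X ^ r := X_dvd_X_pow hr
  -- This differentiates the triple product at a zero. The index-0 factor is `1 - (1 - ε) = ε`, so
  -- the product is `ε * G` with `G` reducing to the cube, and the `ε`-part of each summand brings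
  -- down the weight `m`.
  have h := hasSum_theta (R := R[ε]) (α := r) (β := 0) hr (c := -(1 + ε)) (d := -(1 - ε))
    (by linear_combination -(eps_mul_eps (R := R)))
  simp only [add_zero, pow_zero, mul_one, map_neg, neg_mul, neg_neg] at h
  rw [qPoch_eq_one_sub_mul (a := C (1 - ε : R[ε])) hX] at h
  have hG : qPoch (C (1 + ε) * X ^ r) (X ^ r) * ((1 - C (1 - ε : R[ε])) *
      qPoch (C (1 - ε) * X ^ r) (X ^ r)) * qPoch (X ^ r) (X ^ r) =
      C (ε : R[ε]) * (qPoch (C (1 + ε) * X ^ r) (X ^ r) * qPoch (C (1 - ε) * X ^ r) (X ^ r) *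
        qPoch (X ^ r) (X ^ r)) := by
    rw [map_sub, map_one]
    ring
  rw [hG] at h
  set G := qPoch (C (1 + ε) * X ^ r) (X ^ r) * qPoch (C (1 - ε) * X ^ r) (X ^ r) *
        qPoch (X ^ r : R[ε]⟦X⟧) (X ^ r) with hGdef
  let φ : R[ε] →+* R := (TrivSqZeroExt.fstHom R R R : R[ε] →ₐ[R] R)
  have hφ : G.map φ = qPoch (X ^ r) (X ^ r) ^ 3 := by
    have e1 : φ (1 + ε) = 1 := by simp [φ]
    have e2 : φ (1 - ε) = 1 := by simp [φ]
    simp only [hGdef, map_mul, map_qPoch, map_pow, map_X, map_C, e1, e2, map_one, one_mul]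
    ring
  rw [WithPiTopology.hasSum_iff_hasSum_coeff] at h ⊢
  intro n
  have h1 := (h n).map (TrivSqZeroExt.sndHom R R) TrivSqZeroExt.continuous_snd
  convert h1 using 1
  · funext m
    simp only [Function.comp, coeff_monomial, TrivSqZeroExt.sndHom_apply]
    split_ifs
    · have := snd_jacobiTerm_one_add_eps (R := R) m
      exact this.symm
    · simp
  · rw [← hφ, coeff_map, coeff_C_mul]
    simp [φ]

end Cube

/-! ### The double theta representation of E₁² E₃² and its vanishing coefficients. -/

section EtaQuotient

variable {R : Type*} [CommRing R] [TopologicalSpace R]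

/-- Euler's pentagonal number theorem. -/
theorem hasSum_qPoch_X :
    HasSum (fun m : ℤ => (monomial (thetaExp 2 1 m) ((m.negOnePow : ℤ) : R) : R⟦X⟧))
      (qPoch X X) := by
  have h := hasSum_theta (R := R) (α := 2) (β := 1) (by norm_num) (c := -1) (d := -1) (by ring)
  have h3 := qPoch_dissect_three (a := (X : R⟦X⟧)) dvd_rfl
  simp only [jacobiTerm_neg_one, map_neg, map_one, neg_mul, one_mul, neg_neg, pow_one,
    Nat.reduceAdd] at h
  rw [← pow_two, ← pow_succ'] at h3
  rw [h3, mul_comm (qPoch X _)]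
  exact h

/-- The index-0 factor of the triple product is `1 - 1`; equivalently, the terms `m` and `-1 - m`
cancel. -/
theorem hasSum_negOnePow_thetaExp {r : ℕ} (hr : r ≠ 0) :
    HasSum (fun m : ℤ => (monomial (thetaExp r 0 m) ((m.negOnePow : ℤ) : R) : R⟦X⟧)) 0 := by
  have h := hasSum_theta (R := R) (α := r) (β := 0) hr (c := -1) (d := -1) (by ring)
  simp only [jacobiTerm_neg_one, map_neg, map_one, neg_mul, one_mul, neg_neg, pow_zero,
    add_zero] at h
  rw [qPoch_eq_one_sub_mul (a := 1) (X_dvd_X_pow hr)] at h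
  simpa using h

theorem hasSum_theta_one {α β : ℕ} (h : α + β ≠ 0) :
    HasSum (fun m => (monomial (thetaExp α β m) 1 : R⟦X⟧))
      (qPoch (-X ^ α) (X ^ (α + β)) * qPoch (-X ^ β) (X ^ (α + β)) *
        qPoch (X ^ (α + β)) (X ^ (α + β))) := by
  have := hasSum_theta (R := R) h (one_mul 1)
  simpa only [jacobiTerm, one_pow, one_mul, map_one] using this

variable [IsTopologicalRing R] [T2Space R]

theorem hasSum_three_mul_cube_mul :
    HasSum (fun p : ℤ × ℤ => (monomial (thetaExp 3 0 p.1 + thetaExp 2 1 p.2)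
      ((((p.1 + p.2).negOnePow : ℤ) : R) * (3 * (p.1 + p.2 : ℤ) + 2 : ℤ)) : R⟦X⟧))
      (3 * (qPoch (X ^ 3) (X ^ 3) ^ 3 * qPoch X X)) := by
  have f3 := finite_thetaExp_le (α := 3) (β := 0) (by norm_num)
  have f2 := finite_thetaExp_le (α := 2) (β := 1) (by norm_num)
  have h1 := (hasSum_monomial_mul f3 f2 (hasSum_qPoch_cube (R := R) three_ne_zero)
    hasSum_qPoch_X).mul_left 3
  -- Adding zero times the series with weight `3 * b + 2` changes the weight `3 * a` into `3 * (a +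
  -- b) + 2`, which after the rotation depends on one variable only.
  have h2 := hasSum_monomial_mul f3 f2 (hasSum_negOnePow_thetaExp (R := R) three_ne_zero)
    (summable_monomial f2 fun b : ℤ => ((b.negOnePow : ℤ) : R) * (3 * b + 2 : ℤ)).hasSum
  have h3 := h1.add h2
  rw [zero_mul, add_zero] at h3
  refine h3.congr_fun fun p => ?_
  have h : (3 : R⟦X⟧) = C 3 := (map_ofNat C 3).symm
  rw [h, ← monomial_zero_eq_C_apply, monomial_mul_monomial, zero_add, ← map_add,
    Int.negOnePow_add]
  congr 1
  push_cast
  ring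

/-- The two ranges consist of the pairs with even and with odd coordinate sum. -/
theorem isCompl_range_add_sub :
    IsCompl (Set.range fun p : ℤ × ℤ => (p.1 + p.2, p.1 - p.2))
      (Set.range fun p : ℤ × ℤ => (p.1 + p.2 - 1, p.1 - p.2)) := by
  constructor
  · rw [Set.disjoint_left]
    rintro _ ⟨p, rfl⟩ ⟨q, hq⟩
    simp only [Prod.mk.injEq] at hq
    omega
  · rw [codisjoint_iff_le_sup]
    rintro ⟨a, b⟩ -
    rcases Int.even_or_odd' (a + b) with ⟨k, hk | hk⟩
    · exact Or.inl ⟨(k, a - k), by ext <;> simp; omega⟩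
    · exact Or.inr ⟨(k + 1, a - k), by ext <;> simp <;> omega⟩

/-- On each parity class of `a + b` the rotated variables separate the exponent, the sign is
constant, and the weight becomes `6i + 2` or `6i - 1`, the derivative of the `i`-part of the
exponent. -/
theorem three_mul_cube_mul_eq :
    3 * (qPoch (X ^ 3) (X ^ 3) ^ 3 * qPoch X X) =
      (∑' i : ℤ, (monomial (thetaExp 5 1 i) ((6 * i + 2 : ℤ) : R) : R⟦X⟧)) *
        (qPoch (-X ^ 4) (X ^ 6) * qPoch (-X ^ 2) (X ^ 6) * qPoch (X ^ 6) (X ^ 6)) -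
      (∑' i : ℤ, (monomial (thetaExp 2 4 i) ((6 * i - 1 : ℤ) : R) : R⟦X⟧)) *
        (qPoch (-X) (X ^ 6) * qPoch (-X ^ 5) (X ^ 6) * qPoch (X ^ 6) (X ^ 6)) := by
  have f1 := finite_thetaExp_le (α := 1) (β := 5) (by norm_num)
  have f2 := finite_thetaExp_le (α := 2) (β := 4) (by norm_num)
  have f4 := finite_thetaExp_le (α := 4) (β := 2) (by norm_num)
  have f5 := finite_thetaExp_le (α := 5) (β := 1) (by norm_num)
  have h0 := hasSum_monomial_mul f5 f4
    (summable_monomial f5 fun i : ℤ => ((6 * i + 2 : ℤ) : R)).hasSum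
    (hasSum_theta_one (R := R) (α := 4) (β := 2) (by norm_num))
  have h1 := (hasSum_monomial_mul f2 f1
    (summable_monomial f2 fun i : ℤ => ((6 * i - 1 : ℤ) : R)).hasSum
    (hasSum_theta_one (R := R) (α := 1) (β := 5) (by norm_num))).neg
  simp only [Nat.reduceAdd, pow_one] at h0 h1
  set F : ℤ × ℤ → R⟦X⟧ := fun p => monomial (thetaExp 3 0 p.1 + thetaExp 2 1 p.2)
      ((((p.1 + p.2).negOnePow : ℤ) : R) * (3 * (p.1 + p.2 : ℤ) + 2 : ℤ)) with hF
  have i0 : Function.Injective fun p : ℤ × ℤ => (p.1 + p.2, p.1 - p.2) := by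
    rintro ⟨a, b⟩ ⟨c, d⟩ h
    simp only [Prod.mk.injEq] at h ⊢
    omega
  have i1 : Function.Injective fun p : ℤ × ℤ => (p.1 + p.2 - 1, p.1 - p.2) := by
    rintro ⟨a, b⟩ ⟨c, d⟩ h
    simp only [Prod.mk.injEq] at h ⊢
    omega
  have e0 : ∀ p : ℤ × ℤ, (F ∘ fun p : ℤ × ℤ => (p.1 + p.2, p.1 - p.2)) p =
      monomial (thetaExp 5 1 p.1 + thetaExp 4 2 p.2) (((6 * p.1 + 2 : ℤ) : R) * 1) := fun p => by
    have e : thetaExp 3 0 (p.1 + p.2) + thetaExp 2 1 (p.1 - p.2) =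
        thetaExp 5 1 p.1 + thetaExp 4 2 p.2 := by
      have a1 := two_mul_thetaExp 3 0 (p.1 + p.2)
      have a2 := two_mul_thetaExp 2 1 (p.1 - p.2)
      have a3 := two_mul_thetaExp 5 1 p.1
      have a4 := two_mul_thetaExp 4 2 p.2
      zify
      push_cast at *
      linarith
    have s : p.1 + p.2 + (p.1 - p.2) = 2 * p.1 := by ring
    simp only [hF, Function.comp, e, s, Int.negOnePow_two_mul]
    congr 1
    push_cast
    ring
  have e1 : ∀ p : ℤ × ℤ, (F ∘ fun p : ℤ × ℤ => (p.1 + p.2 - 1, p.1 - p.2)) p =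
      -monomial (thetaExp 2 4 p.1 + thetaExp 1 5 p.2) (((6 * p.1 - 1 : ℤ) : R) * 1) := fun p => by
    have e : thetaExp 3 0 (p.1 + p.2 - 1) + thetaExp 2 1 (p.1 - p.2) =
        thetaExp 2 4 p.1 + thetaExp 1 5 p.2 := by
      have a1 := two_mul_thetaExp 3 0 (p.1 + p.2 - 1)
      have a2 := two_mul_thetaExp 2 1 (p.1 - p.2)
      have a3 := two_mul_thetaExp 2 4 p.1
      have a4 := two_mul_thetaExp 1 5 p.2
      zify
      push_cast at *
      linarith
    have s : p.1 + p.2 - 1 + (p.1 - p.2) = 2 * p.1 - 1 := by ring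
    have s' : (2 * p.1 - 1).negOnePow = -1 := Int.negOnePow_odd _ ⟨p.1 - 1, by ring⟩
    simp only [hF, Function.comp, e, s, s', ← map_neg]
    congr 1
    push_cast
    ring
  have g0 := i0.hasSum_range_iff.2 (h0.congr_fun e0)
  have g1 := i1.hasSum_range_iff.2 (h1.congr_fun e1)
  rw [sub_eq_add_neg]
  exact HasSum.unique (f := F) hasSum_three_mul_cube_mul (g0.add_isCompl isCompl_range_add_sub g1)

/-- A theta series representation of `(q; q)² (q³; q³)²`, in terms of a primitive cube root of
unity `w`. -/
theorem three_mul_sq_mul_sq_eq {w : R} (hw : 1 + w + w ^ 2 = 0) :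
    3 * (qPoch X X ^ 2 * qPoch (X ^ 3) (X ^ 3) ^ 2) =
      (∑' i : ℤ, (monomial (thetaExp 5 1 i) ((6 * i + 2 : ℤ) : R) : R⟦X⟧)) *
        (∑' m : ℤ, (monomial (thetaExp 1 1 m) (jacobiTerm w (w ^ 2) m) : R⟦X⟧)) +
      C w ^ 2 * (∑' i : ℤ, (monomial (thetaExp 2 4 i) ((6 * i - 1 : ℤ) : R) : R⟦X⟧)) *
        (∑' m : ℤ, (monomial (thetaExp 2 0 m) (jacobiTerm w (w ^ 2) m) : R⟦X⟧)) := by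
  have hw3 : w * w ^ 2 = 1 := by linear_combination (w - 1) * hw
  have hW : 1 + C w + (C w : R⟦X⟧) ^ 2 = 0 := by
    rw [← map_pow, ← map_one C, ← map_add, ← map_add, hw, map_zero]
  have h0 := three_mul_cube_mul_eq (R := R)
  have h1 := (hasSum_theta (α := 1) (β := 1) (by norm_num) hw3).tsum_eq
  have h2 := (hasSum_theta (α := 2) (β := 0) (by norm_num) hw3).tsum_eq
  have h4 := qPoch_one_mul_theta_four_two hW
  have h5 := qPoch_one_mul_theta_one_five hW
  -- The peeled factor `1 + w ^ 2` is `-w`, so the prefactor `w ^ 2` turns it into `-1`, the sign of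
  -- the second double sum.
  have h6 := qPoch_eq_one_sub_mul (a := -(C w ^ 2)) (X_dvd_X_pow (R := R) two_ne_zero)
  simp only [Nat.reduceAdd, pow_one, map_pow, pow_zero, mul_one, neg_mul] at h1 h2 h6
  rw [h6] at h2
  rw [h1, h2]
  refine (isUnit_qPoch (Q := X ^ 3) (X_dvd_X_pow (R := R) three_ne_zero)).mul_left_cancel ?_
  generalize (∑' i : ℤ, (monomial (thetaExp 5 1 i) ((6 * i + 2 : ℤ) : R) : R⟦X⟧)) = B at *
  generalize (∑' i : ℤ, (monomial (thetaExp 2 4 i) ((6 * i - 1 : ℤ) : R) : R⟦X⟧)) = A at *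
  generalize qPoch (X ^ 3 : R⟦X⟧) (X ^ 3) = E3 at *
  generalize qPoch (X : R⟦X⟧) X = E1 at *
  generalize qPoch (X ^ 2 : R⟦X⟧) (X ^ 2) = q22 at *
  generalize qPoch (-(C w * X ^ 2) : R⟦X⟧) (X ^ 2) = u at *
  generalize qPoch (-(C w ^ 2 * X ^ 2) : R⟦X⟧) (X ^ 2) = v at *
  linear_combination E1 * h0 + B * h4 - A * h5 -
    E3 * A * u * v * q22 * (1 - C w + C w ^ 2) * hW

variable {K : Type*} [Field K] [CharP K 5]

theorem coeff_sq_mul_sq_eq_zero {w : K} (hw : 1 + w + w ^ 2 = 0) {n : ℕ} (hn : n % 5 = 3) :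
    coeff n (qPoch (X : K⟦X⟧) X ^ 2 * qPoch (X ^ 3) (X ^ 3) ^ 2) = 0 := by
  let _ : TopologicalSpace K := ⊥
  have : DiscreteTopology K := ⟨rfl⟩
  have f1 := finite_thetaExp_le (α := 1) (β := 1) (by norm_num)
  have f2 := finite_thetaExp_le (α := 2) (β := 0) (by norm_num)
  have f2' := finite_thetaExp_le (α := 2) (β := 4) (by norm_num)
  have f5 := finite_thetaExp_le (α := 5) (β := 1) (by norm_num)
  have hn' : ((n : ℤ) : ZMod 5) = 3 := by
    have : ((n : ℕ) : ZMod 5) = ((3 : ℕ) : ZMod 5) :=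
      (ZMod.natCast_eq_natCast_iff _ _ _).2 (by rw [Nat.ModEq, hn])
    exact_mod_cast this
  -- Completing squares gives `(3x + 1)² + 3y² = 0` here and `(6x - 1)² + 3(2y + 1)² = 0` below;
  -- `-3` is a non-residue mod 5.
  have key0 : ∀ x y : ZMod 5, 3 * x ^ 2 + 2 * x + y ^ 2 = 3 → 6 * x + 2 = 0 := by decide
  have key1 : ∀ x y : ZMod 5, 3 * x ^ 2 - x + y ^ 2 + y = 3 → 6 * x - 1 = 0 := by decide
  have hB := coeff_eq_zero_of_hasSum_monomial (n := n) (hasSum_monomial_mul f5 f1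
    (summable_monomial f5 fun i : ℤ => ((6 * i + 2 : ℤ) : K)).hasSum
    (summable_monomial f1 fun m : ℤ => jacobiTerm w (w ^ 2) m).hasSum) fun p hp => by
      have a1 := two_mul_thetaExp 5 1 p.1
      have a2 := two_mul_thetaExp 1 1 p.2
      have a3 : 3 * p.1 ^ 2 + 2 * p.1 + p.2 ^ 2 = n := by
        rw [← hp]; push_cast at *; linarith
      have a4 := congrArg (Int.cast : ℤ → ZMod 5) a3
      rw [hn'] at a4
      push_cast at a4
      replace a4 := key0 _ _ a4
      have a5 : ((6 * p.1 + 2 : ℤ) : K) = 0 := by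
        rw [CharP.intCast_eq_zero_iff K 5, ← CharP.intCast_eq_zero_iff (ZMod 5) 5]
        push_cast
        exact a4
      rw [a5, zero_mul]
  have hA := coeff_eq_zero_of_hasSum_monomial (n := n) (hasSum_monomial_mul f2' f2
    (summable_monomial f2' fun i : ℤ => ((6 * i - 1 : ℤ) : K)).hasSum
    (summable_monomial f2 fun m : ℤ => jacobiTerm w (w ^ 2) m).hasSum) fun p hp => by
      have a1 := two_mul_thetaExp 2 4 p.1
      have a2 := two_mul_thetaExp 2 0 p.2
      have a3 : 3 * p.1 ^ 2 - p.1 + p.2 ^ 2 + p.2 = n := by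
        rw [← hp]; push_cast at *; linarith
      have a4 := congrArg (Int.cast : ℤ → ZMod 5) a3
      rw [hn'] at a4
      push_cast at a4
      replace a4 := key1 _ _ a4
      have a5 : ((6 * p.1 - 1 : ℤ) : K) = 0 := by
        rw [CharP.intCast_eq_zero_iff K 5, ← CharP.intCast_eq_zero_iff (ZMod 5) 5]
        push_cast
        exact a4
      rw [a5, zero_mul]
  have h := congrArg (coeff n) (three_mul_sq_mul_sq_eq hw)
  rw [map_add, hB, mul_assoc, ← map_pow, coeff_C_mul, hA, mul_zero, add_zero,
    ← map_ofNat (C (R := K)) 3, coeff_C_mul] at h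
  refine (mul_eq_zero.1 h).resolve_left fun h3 => ?_
  have : (5 : ℕ) ∣ 3 := (CharP.cast_eq_zero_iff K 5 3).1 (by exact_mod_cast h3)
  omega

end EtaQuotient

/-! ### The generating function of colored partitions. -/

section GeneratingFunction

variable {R : Type*} [CommRing R]

/-- The geometric series `∑ X ^ (s * j)`. -/
noncomputable def geomSeries (R : Type*) [CommRing R] (s : ℕ) : R⟦X⟧ :=
  PowerSeries.mk fun n => if s ∣ n then 1 else 0

theorem geomSeries_mul_one_sub {s : ℕ} (hs : 0 < s) : geomSeries R s * (1 - X ^ s) = 1 := by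
  ext n
  rw [mul_sub, mul_one, map_sub, coeff_mul_X_pow', geomSeries, coeff_mk, coeff_mk, coeff_one]
  rcases lt_or_ge n s with h | h
  · rw [if_neg h.not_ge, sub_zero]
    exact if_congr ⟨fun hd => Nat.eq_zero_of_dvd_of_lt hd h, fun h0 => h0 ▸ dvd_zero s⟩ rfl rfl
  · rw [if_pos h, if_congr (Nat.dvd_sub_iff_left h dvd_rfl) rfl rfl, sub_self, if_neg (by omega)]

/-- The colored parts of size at most `N`. -/
def coloredParts (k r N : ℕ) : Finset (ℕ × ℕ) :=
  (range (N + 1) ×ˢ range (2 * k)).filter fun x => 0 < x.1 ∧ x.2 < numColors k r x.1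

theorem numColors_le (k r m : ℕ) : numColors k r m ≤ 2 * k := by
  unfold numColors
  split_ifs <;> omega

theorem ColoredPartition.sum_count {k r n N : ℕ} (p : ColoredPartition k r n) (h : n ≤ N) :
    (∀ x ∉ coloredParts k r N, p.parts.count x = 0) ∧
      ∑ x ∈ coloredParts k r N, x.1 * p.parts.count x = n := by
  have h1 : ∀ x ∈ p.parts, x ∈ coloredParts k r N := fun x hx => by
    have h2 := Multiset.single_le_sum (s := p.parts.map Prod.fst) (fun _ _ => Nat.zero_le _)
      x.1 (Multiset.mem_map_of_mem _ hx)
    rw [p.parts_sum] at h2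
    have h3 := p.color_lt x hx
    have h4 := numColors_le k r x.1
    rw [coloredParts, mem_filter, mem_product, mem_range, mem_range]
    exact ⟨⟨by omega, by omega⟩, p.parts_pos x hx, h3⟩
  refine ⟨fun x hx => Multiset.count_eq_zero_of_notMem fun hm => hx (h1 x hm), ?_⟩
  have h2 := p.parts_sum
  rw [Finset.sum_multiset_map_count] at h2
  refine Eq.trans (Eq.symm ?_) h2
  refine (sum_subset (fun x hx => h1 x (Multiset.mem_toFinset.1 hx)) fun x _ hx => ?_).trans
    (sum_congr rfl fun x _ => ?_)
  · rw [Multiset.mem_toFinset] at hx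
    simp [Multiset.count_eq_zero_of_notMem hx]
  · rw [smul_eq_mul, mul_comm]

/-- A colored partition corresponds to the function sending a colored part to its size times its
multiplicity. This matches the index set in the coefficient of a finite product of geometric series.
-/
theorem coloredPartitionCount_eq_card {k r n N : ℕ} (h : n ≤ N) :
    coloredPartitionCount k r n =
      (((coloredParts k r N).finsuppAntidiag n).filter
        fun l => ∀ x ∈ coloredParts k r N, x.1 ∣ l x).card := by
  set S := coloredParts k r N with hS
  have hpos : ∀ x ∈ S, 0 < x.1 := fun x hx => (mem_filter.1 hx).2.1
  have hlt : ∀ x ∈ S, x.2 < numColors k r x.1 := fun x hx => (mem_filter.1 hx).2.2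
  set T := (S.finsuppAntidiag n).filter fun l => ∀ x ∈ S, x.1 ∣ l x with hT
  have hTmem : ∀ l, l ∈ T ↔ (∑ x ∈ S, l x = n ∧ l.support ⊆ S) ∧ ∀ x ∈ S, x.1 ∣ l x := fun l => by
    rw [hT, mem_filter, mem_finsuppAntidiag]
  let f (p : ColoredPartition k r n) : ℕ × ℕ →₀ ℕ :=
    Finsupp.onFinset S (fun x => x.1 * p.parts.count x) fun x hx => by
      by_contra hS
      exact hx (by rw [(p.sum_count h).1 x hS, mul_zero])
  have hf : ∀ p, f p ∈ T := fun p => by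
    rw [hTmem]
    exact ⟨⟨(p.sum_count h).2, Finsupp.support_onFinset_subset⟩, fun x _ => dvd_mul_right _ _⟩
  have hbij : Function.Bijective fun p => (⟨f p, hf p⟩ : T) := by
    constructor
    · intro p q hpq
      have hpq' : f p = f q := congrArg Subtype.val hpq
      ext x
      by_cases hx : x ∈ S
      · exact Nat.eq_of_mul_eq_mul_left (hpos x hx) (DFunLike.congr_fun hpq' x)
      · rw [(p.sum_count h).1 x hx, (q.sum_count h).1 x hx]
    · rintro ⟨l, hl⟩
      rw [hTmem] at hl
      obtain ⟨⟨hsum, hsupp⟩, hdvd⟩ := hl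
      let m : Multiset (ℕ × ℕ) := ∑ x ∈ S, (l x / x.1) • {x}
      have hm : ∀ x ∈ m, x ∈ S := fun x hx => by
        obtain ⟨y, hy, hxy⟩ := Multiset.mem_sum.1 hx
        rwa [Multiset.mem_singleton.1 (Multiset.mem_of_mem_nsmul hxy)]
      have hcount : ∀ x ∈ S, m.count x = l x / x.1 := fun x hx => by
        simp only [m, Multiset.count_sum', Multiset.count_nsmul, Multiset.count_singleton]
        simp [hx]
      have hms : (m.map Prod.fst).sum = n := by
        simp only [m, ← Multiset.coe_mapAddMonoidHom, ← Multiset.coe_sumAddMonoidHom, map_sum,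
          map_nsmul]
        rw [← hsum]
        refine sum_congr rfl fun x hx => ?_
        simpa using Nat.div_mul_cancel (hdvd x hx)
      refine ⟨⟨m, fun x hx => hpos x (hm x hx), fun x hx => hlt x (hm x hx), hms⟩, ?_⟩
      refine Subtype.ext (Finsupp.ext fun x => ?_)
      change x.1 * m.count x = l x
      by_cases hx : x ∈ S
      · rw [hcount x hx, Nat.mul_div_cancel' (hdvd x hx)]
      · rw [Multiset.count_eq_zero_of_notMem fun h => hx (hm x h), mul_zero,
          Finsupp.notMem_support_iff.1 fun h => hx (hsupp h)]
  rw [coloredPartitionCount, Nat.card_eq_of_bijective _ hbij, Nat.card_eq_fintype_card,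
    Fintype.card_coe]

theorem coeff_prod_geomSeries {k r n N : ℕ} (h : n ≤ N) :
    coeff n (∏ x ∈ coloredParts k r N, geomSeries R x.1) = (coloredPartitionCount k r n : R) := by
  classical
  rw [coeff_prod, coloredPartitionCount_eq_card h, card_filter, Nat.cast_sum]
  refine sum_congr rfl fun l _ => ?_
  simp only [geomSeries, coeff_mk]
  rw [prod_ite_zero]
  simp

theorem prod_one_sub_coloredParts (k r N : ℕ) :
    ∏ x ∈ coloredParts k r N, (1 - X ^ x.1 : R⟦X⟧) =
      ∏ m ∈ range N, (1 - X ^ (m + 1)) ^ numColors k r (m + 1) := by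
  rw [coloredParts, prod_filter, prod_product, prod_range_succ']
  have h0 : ∏ c ∈ range (2 * k), (if 0 < 0 ∧ c < numColors k r 0 then (1 - X ^ 0 : R⟦X⟧) else 1)
      = 1 := by simp
  rw [h0, mul_one]
  refine prod_congr rfl fun m _ => ?_
  have h1 : (range (2 * k)).filter (fun c => c < numColors k r (m + 1)) =
      range (numColors k r (m + 1)) := by
    have := numColors_le k r (m + 1)
    ext c
    simp only [mem_filter, mem_range]
    omega
  simp only [Nat.succ_pos, true_and]
  rw [← prod_filter, h1, prod_const, card_range]

/-- Truncating at `r * N` captures exactly the first `N` multiples of `r`; their `k` extra colors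
form the second product. -/
theorem prod_one_sub_pow_numColors (k r N : ℕ) (hr : 0 < r) :
    ∏ m ∈ range (r * N), (1 - X ^ (m + 1) : R⟦X⟧) ^ numColors k r (m + 1) =
      (∏ i ∈ range (r * N), (1 - X * X ^ i)) ^ k *
        (∏ i ∈ range N, (1 - X ^ r * (X ^ r) ^ i)) ^ k := by
  have h : ∏ i ∈ range N, (1 - X ^ r * (X ^ r) ^ i : R⟦X⟧) =
      ∏ m ∈ (range (r * N)).filter (fun m => r ∣ m + 1), (1 - X ^ (m + 1)) := by
    refine prod_bij (fun j _ => r * (j + 1) - 1) ?_ ?_ ?_ ?_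
    · intro j hj
      have h1 : 0 < r * (j + 1) := by positivity
      have h2 : r * (j + 1) ≤ r * N := Nat.mul_le_mul_left r (mem_range.1 hj)
      rw [mem_filter, mem_range, Nat.sub_add_cancel h1]
      exact ⟨by omega, dvd_mul_right _ _⟩
    · intro i _ j _ hij
      have h1 : 0 < r * (i + 1) := by positivity
      have h2 : 0 < r * (j + 1) := by positivity
      have h3 : r * (i + 1) = r * (j + 1) := by omega
      have := Nat.eq_of_mul_eq_mul_left hr h3
      omega
    · intro m hm
      rw [mem_filter, mem_range] at hm
      obtain ⟨h1, c, hc⟩ := hm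
      have hc0 : c ≠ 0 := by rintro rfl; omega
      have hcN : c ≤ N := Nat.le_of_mul_le_mul_left (by omega : r * c ≤ r * N) hr
      exact ⟨c - 1, by rw [mem_range]; omega, by rw [Nat.sub_add_cancel (by omega), ← hc]; rfl⟩
    · intro j _
      have h1 : 0 < r * (j + 1) := by positivity
      rw [Nat.sub_add_cancel h1, pow_mul, pow_succ' (X ^ r)]
  rw [h, prod_filter, ← mul_pow, ← prod_mul_distrib, ← prod_pow]
  refine prod_congr rfl fun m _ => ?_
  unfold numColors
  split_ifs
  · rw [two_mul, pow_add, mul_pow, pow_succ']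
  · rw [mul_one, pow_succ']

/-- The generating function of `coloredPartitionCount` is `1 / (E₁ ^ k * E_r ^ k)`. -/
theorem coloredPartitionCount_genFun (k : ℕ) {r : ℕ} (hr : 0 < r) :
    (PowerSeries.mk fun n => (coloredPartitionCount k r n : R)) *
      (qPoch X X ^ k * qPoch (X ^ r) (X ^ r) ^ k) = 1 := by
  refine eq_of_forall_X_pow_dvd_sub fun n => ?_
  have hn : n ≤ r * n := Nat.le_mul_of_pos_left n hr
  have h1 : X ^ n ∣ (PowerSeries.mk fun n => (coloredPartitionCount k r n : R)) -
      ∏ x ∈ coloredParts k r (r * n), geomSeries R x.1 := by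
    rw [X_pow_dvd_iff]
    intro m hm
    rw [map_sub, coeff_mk, coeff_prod_geomSeries (by omega), sub_self]
  have h2 := ((pow_dvd_pow X hn).trans (X_pow_dvd_qPoch_sub_prod (a := (X : R⟦X⟧)) dvd_rfl
    (r * n))).trans (sub_dvd_pow_sub_pow _ _ k)
  have h3 := (X_pow_dvd_qPoch_sub_prod (a := (X ^ r : R⟦X⟧)) (X_dvd_X_pow hr.ne') n).trans
    (sub_dvd_pow_sub_pow _ _ k)
  convert X_pow_dvd_mul_sub_mul h1 (X_pow_dvd_mul_sub_mul h2 h3) using 2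
  rw [← prod_one_sub_pow_numColors k r n hr, ← prod_one_sub_coloredParts, ← prod_mul_distrib]
  refine (prod_eq_one fun x hx => geomSeries_mul_one_sub ?_).symm
  exact (mem_filter.1 hx).2.1

end GeneratingFunction

/-! ### Substituting a power of the variable. -/

section Expand

variable {R : Type*} [CommRing R]

theorem expand_qPoch {p : ℕ} (hp : p ≠ 0) {a Q : R⟦X⟧} (hQ : X ∣ Q) :
    expand p hp (qPoch a Q) = qPoch (expand p hp a) (expand p hp Q) := by
  symm
  have hX : ∀ n : ℕ, (X : R⟦X⟧) ^ n ∣ expand p hp (X ^ n) := fun n => by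
    rw [map_pow, expand_X]
    exact pow_dvd_pow_of_dvd (X_dvd_X_pow hp) n
  have hQ' : X ∣ expand p hp Q := by
    have h := (hX 1).trans (map_dvd (expand p hp) ((pow_one (X : R⟦X⟧)).dvd.trans hQ))
    rwa [pow_one] at h
  refine qPoch_eq_of_forall_dvd hQ' one_pos fun n => ?_
  have h := (hX n).trans (map_dvd (expand p hp) (X_pow_dvd_qPoch_sub_prod (a := a) hQ n))
  simpa [map_prod] using h

theorem coeff_mul_expand_eq_zero {p : ℕ} (hp : p ≠ 0) {T U : R⟦X⟧} {n : ℕ}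
    (h : ∀ m, m % p = n % p → coeff m T = 0) : coeff n (T * expand p hp U) = 0 := by
  rw [coeff_mul]
  refine sum_eq_zero fun x hx => ?_
  rw [HasAntidiagonal.mem_antidiagonal] at hx
  by_cases hd : p ∣ x.2
  · rw [h x.1 (by rw [← hx, Nat.add_mod, Nat.mod_eq_zero_of_dvd hd, add_zero, Nat.mod_mod]),
      zero_mul]
  · rw [coeff_expand_of_not_dvd p hp _ hd, mul_zero]

end Expand

/-! ### The congruence. -/

theorem mainTheorem9 (n : ℕ) : coloredPartitionCount 3 3 (5 * n + 3) ≡ 0 [MOD 5] := by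
  have : Fact (Nat.Prime 5) := ⟨by norm_num⟩
  -- `ZMod 5` has no primitive cube root of unity, since 3 does not divide 4; vanishing of the count
  -- in an extension field still means divisibility by 5.
  let K := AlgebraicClosure (ZMod 5)
  have : CharP K 5 := charP_of_injective_algebraMap (algebraMap (ZMod 5) K).injective 5
  obtain ⟨w, hw⟩ : ∃ w : K, 1 + w + w ^ 2 = 0 := by
    obtain ⟨w, hw⟩ := IsAlgClosed.exists_root (Polynomial.X ^ 2 + Polynomial.X + 1 : Polynomial K)
      (by
        have : (Polynomial.X ^ 2 + Polynomial.X + 1 : Polynomial K).degree = 2 := by compute_degree!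
        rw [this]; norm_num)
    refine ⟨w, ?_⟩
    simp only [Polynomial.IsRoot.def, Polynomial.eval_add, Polynomial.eval_pow, Polynomial.eval_X,
      Polynomial.eval_one] at hw
    linear_combination hw
  have hF := coloredPartitionCount_genFun (R := K) 3 (r := 3) (by norm_num)
  set F : K⟦X⟧ := PowerSeries.mk fun n => (coloredPartitionCount 3 3 n : K) with hFdef
  have h5 : 5 ≠ 0 := by norm_num
  have h3 : (X : K⟦X⟧) ∣ X ^ 3 := X_dvd_X_pow three_ne_zero
  obtain ⟨V, hV⟩ := ((isUnit_qPoch (Q := X) (dvd_refl (X : K⟦X⟧))).mul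
    (isUnit_qPoch (Q := X ^ 3) h3)).exists_right_inv
  have hU : expand 5 h5 (qPoch (X : K⟦X⟧) X * qPoch (X ^ 3) (X ^ 3)) =
      qPoch X X ^ 5 * qPoch (X ^ 3) (X ^ 3) ^ 5 := by
    rw [map_mul, expand_qPoch _ dvd_rfl, expand_qPoch _ h3, qPoch_pow_char dvd_rfl,
      qPoch_pow_char h3, map_pow, expand_X, ← pow_mul, ← pow_mul]
  have hV' := congrArg (expand 5 h5) hV
  rw [map_mul, map_one, hU] at hV'
  -- The expanded `V` is the inverse of `E₁⁵ E₃⁵`, and it is a series in `X ^ 5`.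
  have hFT : F = qPoch (X : K⟦X⟧) X ^ 2 * qPoch (X ^ 3) (X ^ 3) ^ 2 *
      expand 5 h5 V := by
    linear_combination (qPoch (X : K⟦X⟧) X ^ 2 * qPoch (X ^ 3) (X ^ 3) ^ 2 *
      expand 5 h5 V) * hF - F * hV'
  have h0 : coeff (5 * n + 3) F = 0 := by
    rw [hFT]
    exact coeff_mul_expand_eq_zero _ fun m hm => coeff_sq_mul_sq_eq_zero hw (by omega)
  rw [hFdef, coeff_mk, CharP.cast_eq_zero_iff K 5] at h0
  exact Nat.modEq_zero_iff_dvd.2 h0
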